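/- **Theorem 3 (Lower Bound).** Let $p\ge 0$ be an integer, $\sigma>0$ and $\gamma_1>0$. Consider $n=2p$ units arranged in $p$ fixed disjoint pairs. A *pair network* is an undirected graph $A$ on the units all of whose edges join the two units of a pair (so each pair is either connected or not); $\mathcal N_i$ denotes the set of neighbors of unit $i$ in $A$. In each round $t=1,2,\dots,T$ the experimenter chooses $\mathbf Z_t\in\{0,1\}^n$ with $\|\mathbf Z_t\|_1\le B=1$ and observes $Y_{t,i}=r_i(\mathbf Z_t)+\varepsilon_{t,i}$ for all units $i$, with independent noise $\varepsilon_{t,i}\sim N(0,\sigma^2)$. A policy chooses $\mathbf Z_t$, possibly at random, from the past assignments and observed outcomes; it may depend on the pairs, on $\sigma$, on $\gamma_1$ and on the horizon $T$, but not on $A$. With $f(\mathbf Z)=\sum_i r_i(\mathbf Z)$, the expected regret of a policy $\pi$ in the environment $(A,r)$ is $$R_T^\pi(A,r)=\sum_{t=1}^T\mathbb E\Big[\max_{\|\mathbf Z\|_1\le 1}f(\mathbf Z)-f(\mathbf Z_t)\Big].$$ Call $\pi$ *consistent* if $R_T^\pi(A,r)=o(T^a)$ as $T\to\infty$ for every $a>0$,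 every pair network $A$ and all mean outcomes $r=(r_i)_i$ that satisfy the Neighborhood Interference Assumption for $A$ ($r_i(\mathbf Z)$ depends only on the treatments of $i$ and of the units in $\mathcal N_i$) and have zero direct effect ($r_i(\mathbf Z)=0$ whenever no unit of $\mathcal N_i$ is treated). For a pair network $A$ let $r^{A}_i(\mathbf Z)=\mu Z_i+\gamma_1\mathbf 1\{\sum_{j\in\mathcal N_i}Z_j=1\}$ with $\mu=0$. Then every consistent policy $\pi$ satisfies $$\liminf_{T\to\infty}\ \frac{\sup_{A}R_T^\pi(A,r^{A})}{\log T}\ \ge\ \frac{2(p-1)\sigma^2}{\gamma_1},$$ where the supremum is over all pair networks $A$. -/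

import Mathlib

open MeasureTheory ProbabilityTheory Filter Topology

noncomputable section

namespace NetworkBandit

/-- Treatment vectors `Z ∈ {0,1}^V` with `‖Z‖₁ ≤ B`. -/
abbrev Assignment (V : Type) [Fintype V] (B : ℕ) : Type :=
  {Z : V → Bool // (Finset.univ.filter fun i => Z i = true).card ≤ B}

/-- A mean outcome function: `r Z i` is the expected outcome of unit `i` under `Z`. -/
abbrev MeanOutcome (V : Type) : Type := (V → Bool) → V → ℝ

/-- What is recorded in one round: the assignment and the noisy outcomes of all units. -/
abbrev Round (V : Type) [Fintype V] (B : ℕ) : Type := Assignment V B × (V → ℝ)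

/-- Neighborhood Interference Assumption: the outcome of unit `i` depends only on the treatments
of `i` and of the neighbors of `i`. -/
def SatisfiesNIA {V : Type} (A : SimpleGraph V) (r : MeanOutcome V) : Prop :=
  ∀ (i : V) (Z Z' : V → Bool), Z i = Z' i → (∀ j, A.Adj i j → Z j = Z' j) → r Z i = r Z' i

/-- Zero direct effect: a unit none of whose neighbors is treated has mean outcome `0`,
whether or not the unit itself is treated. -/
def ZeroDirectEffect {V : Type} (A : SimpleGraph V) (r : MeanOutcome V) : Prop :=
  ∀ (i : V) (Z : V → Bool), (∀ j, A.Adj i j → Z j = false) → r Z i = 0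

/-- Number of treated neighbors of `i`. -/
def treatedNeighbors {V : Type} (A : SimpleGraph V) (Z : V → Bool) (i : V) : ℕ :=
  {j : V | A.Adj i j ∧ Z j = true}.ncard

/-- The reward `r_i(Z) = μ Z_i + γ₁ 1{exactly one neighbor of i is treated}`. -/
def spilloverMean {V : Type} (μ γ₁ : ℝ) (A : SimpleGraph V) : MeanOutcome V := fun Z i =>
  μ * (if Z i = true then 1 else 0) + γ₁ * (if treatedNeighbors A Z i = 1 then 1 else 0)

/-- A (possibly randomized) policy. `rule T t` is the conditional law of the assignment of the
round that follows `t` completed rounds, given the observed history, when the horizon is `T`.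
A policy that does not use the horizon is one whose `rule` does not depend on `T`. -/
structure Policy (V : Type) [Fintype V] (B : ℕ) where
  rule : (T t : ℕ) → Kernel (Fin t → Round V B) (Assignment V B)
  isMarkov : ∀ T t, IsMarkovKernel (rule T t)

/-- Outcomes given the assignment `Z`: independent over units, unit `i` has law
`N(r_i(Z), σ²)`. -/
def outcomeKernel {V : Type} [Fintype V] {B : ℕ} (σ : ℝ) (r : MeanOutcome V) :
    Kernel (Assignment V B) (V → ℝ) :=
  Kernel.ofFunOfCountable fun Z =>
    Measure.pi fun i => gaussianReal (r Z.1 i) (Real.toNNReal (σ ^ 2))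

/-- The law of the first `t` rounds when `π` plays with horizon `T`. -/
def historyLaw {V : Type} [Fintype V] {B : ℕ} (σ : ℝ) (r : MeanOutcome V) (π : Policy V B)
    (T : ℕ) : (t : ℕ) → Measure (Fin t → Round V B)
  | 0 => Measure.dirac Fin.elim0
  | t + 1 =>
      ((historyLaw σ r π T t) ⊗ₘ
        ((π.rule T t) ⊗ₖ
          (Kernel.prodMkLeft (Fin t → Round V B) (outcomeKernel (B := B) σ r)))).map
        fun hx => Fin.snoc (α := fun _ => Round V B) hx.1 hx.2

/-- Total mean outcome `f(Z) = ∑ i, r_i(Z)`. -/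
def totalMean {V : Type} [Fintype V] (r : MeanOutcome V) (Z : V → Bool) : ℝ := ∑ i, r Z i

/-- Expected regret over `T` rounds against the best assignment within the budget. -/
def expectedRegret {V : Type} [Fintype V] {B : ℕ} (σ : ℝ) (r : MeanOutcome V) (π : Policy V B)
    (T : ℕ) : ℝ :=
  ∑ t : Fin T, ∫ h, ((⨆ Z : Assignment V B, totalMean r Z.1) - totalMean r (h t).1.1)
    ∂(historyLaw σ r π T T)

/-- The `2p` nodes, arranged in `p` disjoint pairs `{(k, false), (k, true)}`. -/
abbrev PairNode (p : ℕ) : Type := Fin p × Bool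

/-- The networks on the `2p` nodes all of whose edges are inside the pairs: each pair is either
connected or not. -/
def PairGraph (p : ℕ) : Type :=
  {A : SimpleGraph (PairNode p) // ∀ u v, A.Adj u v → u.1 = v.1}

/-- Consistency: sub-polynomial expected regret in every environment, that is, for
every pair network and all mean outcomes that satisfy neighborhood interference with zero direct
effect. -/
def IsConsistent {p B : ℕ} (σ : ℝ) (π : Policy (PairNode p) B) : Prop :=
  ∀ (A : PairGraph p) (r : MeanOutcome (PairNode p)),
    SatisfiesNIA A.1 r → ZeroDirectEffect A.1 r →
      ∀ a : ℝ, 0 < a →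
        Tendsto (fun T : ℕ => expectedRegret σ r π T / (T : ℝ) ^ a) atTop (𝓝 0)

end NetworkBandit

end

noncomputable section

namespace NetworkBandit

/-! The argument is a two-environment change of measure in the style of Lai and Robbins. In the base
environment only pair `i` is connected, so every treatment in another pair loses `γ₁`
(`sum_expectedPlays_le_expectedRegret`); it remains to show that each of the `p - 1` other pairs
must be tried about `2σ²/γ₁² · log T` times.

For `k ≠ i`, let pair `k` instead have spillover `γ₁ + δ`. This alternative is not some `r^A`, but
consistency covers it. There pair `k` is the unique best choice, so consistency makes the event
"fewer than `T/2` treatments in pair `k`" have probability `o(T^(a-1))`, while in the base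
environment its probability tends to one. The two history laws can be told apart only through the
partner of a treated unit of pair `k`, so their relative entropy is `(γ₁ + δ)²/(2σ²)` times the
expected number of such treatments (`neg_integral_sum_logLikelihoodRatio`).

`mul_log_sub_le_neg_integral` with threshold `M = T^(1-a)` forces this entropy to be at least about
`(1 - a) log T`. Summing over `k`, multiplying by `γ₁` and letting `δ, a → 0` gives the constant. -/

/-! ### Densities of Gaussian and product measures. -/

lemma gaussianReal_eq_withDensity_gaussianReal (m m' : ℝ) {v : NNReal} (hv : v ≠ 0) :
    gaussianReal m' v = (gaussianReal m v).withDensity fun x =>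
      ENNReal.ofReal (Real.exp ((m' - m) * x / v - (m' ^ 2 - m ^ 2) / (2 * v))) := by
  have hv' : (v : ℝ) ≠ 0 := by exact_mod_cast hv
  rw [gaussianReal_of_var_ne_zero _ hv, gaussianReal_of_var_ne_zero _ hv,
    ← withDensity_mul _ (measurable_gaussianPDF m v) (by fun_prop)]
  congr 1
  ext x
  rw [Pi.mul_apply, gaussianPDF_def, gaussianPDF_def]
  dsimp only
  rw [← ENNReal.ofReal_mul (gaussianPDFReal_nonneg _ _ _), gaussianPDFReal_def,
    gaussianPDFReal_def]
  dsimp only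
  rw [mul_assoc _ (Real.exp _), ← Real.exp_add]
  congr 3
  field_simp
  ring

/-- On a box the integrand, cut off by the indicator, is a product of functions of single
coordinates. These are independent under the product measure, so the integral factorizes. -/
lemma pi_withDensity {ι : Type*} [Fintype ι] {X : ι → Type*} [∀ i, MeasurableSpace (X i)]
    (μ : ∀ i, Measure (X i)) [∀ i, IsProbabilityMeasure (μ i)] (f : ∀ i, X i → ENNReal)
    (hf : ∀ i, Measurable (f i)) [∀ i, SigmaFinite ((μ i).withDensity (f i))] :
    Measure.pi (fun i => (μ i).withDensity (f i)) =
      (Measure.pi μ).withDensity fun x => ∏ i, f i (x i) := by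
  refine Measure.pi_eq fun s hs => ?_
  rw [withDensity_apply _ (MeasurableSet.univ_pi hs),
    ← lintegral_indicator (MeasurableSet.univ_pi hs)]
  have h1 : (Set.univ.pi s).indicator (fun x => ∏ i, f i (x i)) =
      fun x => ∏ i, (s i).indicator (f i) (x i) := by
    classical
    ext x
    by_cases hx : x ∈ Set.univ.pi s
    · rw [Set.indicator_of_mem hx]
      exact Finset.prod_congr rfl fun i _ => (Set.indicator_of_mem (hx i trivial) _).symm
    · rw [Set.indicator_of_notMem hx]
      simp only [Set.mem_pi, Set.mem_univ, true_imp_iff, not_forall] at hx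
      obtain ⟨i, hi⟩ := hx
      exact (Finset.prod_eq_zero (Finset.mem_univ i) (Set.indicator_of_notMem hi _)).symm
  have hm : ∀ i, Measurable ((s i).indicator (f i)) := fun i => (hf i).indicator (hs i)
  have hind : iIndepFun (fun i (x : ∀ i, X i) => (s i).indicator (f i) (x i)) (Measure.pi μ) :=
    iIndepFun_pi fun i => (hm i).aemeasurable
  have h2 := lintegral_prod_eq_prod_lintegral_of_indepFun (μ := Measure.pi μ) Finset.univ
    (fun i (x : ∀ i, X i) => (s i).indicator (f i) (x i)) hind
    (fun i => (hm i).comp (measurable_pi_apply i))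
  simp only [h1]
  rw [h2]
  refine Finset.prod_congr rfl fun i _ => ?_
  rw [(measurePreserving_eval μ i).lintegral_comp (hm i), lintegral_indicator (hs i),
    withDensity_apply _ (hs i)]

/-! ### Likelihood ratio of a single round. -/

variable {V : Type} [Fintype V] {B : ℕ}

instance (σ : ℝ) (r : MeanOutcome V) : IsMarkovKernel (outcomeKernel (B := B) σ r) :=
  ⟨fun Z => by
    change IsProbabilityMeasure
      (Measure.pi fun i => gaussianReal (r Z.1 i) (Real.toNNReal (σ ^ 2)))
    infer_instance⟩

lemma outcomeKernel_apply (σ : ℝ) (r : MeanOutcome V) (Z : Assignment V B) :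
    outcomeKernel σ r Z = Measure.pi fun i => gaussianReal (r Z.1 i) (Real.toNNReal (σ ^ 2)) :=
  rfl

/-- The log-likelihood ratio of one round between the mean outcomes `r'` and `r`. -/
def logLikelihoodRatio (σ : ℝ) (r r' : MeanOutcome V) (x : Round V B) : ℝ :=
  ∑ i, ((r' x.1.1 i - r x.1.1 i) * x.2 i / σ ^ 2
    - (r' x.1.1 i ^ 2 - r x.1.1 i ^ 2) / (2 * σ ^ 2))

@[fun_prop]
lemma measurable_logLikelihoodRatio (σ : ℝ) (r r' : MeanOutcome V) :
    Measurable (logLikelihoodRatio (B := B) σ r r') := by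
  refine measurable_from_prod_countable_right fun Z => ?_
  unfold logLikelihoodRatio
  fun_prop

lemma outcomeKernel_eq_withDensity {σ : ℝ} (hσ : 0 < σ) (r r' : MeanOutcome V)
    (Z : Assignment V B) :
    outcomeKernel σ r' Z = (outcomeKernel σ r Z).withDensity fun y =>
      ENNReal.ofReal (Real.exp (logLikelihoodRatio σ r r' (Z, y))) := by
  have hv : Real.toNNReal (σ ^ 2) ≠ 0 := by
    rw [Ne, Real.toNNReal_eq_zero, not_le]; positivity
  have hv' : ((Real.toNNReal (σ ^ 2) : NNReal) : ℝ) = σ ^ 2 := Real.coe_toNNReal _ (by positivity)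
  have key := fun i => gaussianReal_eq_withDensity_gaussianReal (r Z.1 i) (r' Z.1 i) hv
  rw [outcomeKernel_apply, outcomeKernel_apply]
  have : ∀ i, SigmaFinite ((gaussianReal (r Z.1 i) (Real.toNNReal (σ ^ 2))).withDensity fun x =>
      ENNReal.ofReal (Real.exp ((r' Z.1 i - r Z.1 i) * x / (Real.toNNReal (σ ^ 2) : NNReal)
        - (r' Z.1 i ^ 2 - r Z.1 i ^ 2) / (2 * (Real.toNNReal (σ ^ 2) : NNReal))))) := fun i => by
    rw [← key i]; infer_instance
  simp_rw [key]
  rw [pi_withDensity _ _ fun i => by fun_prop]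
  congr 1
  ext y
  rw [← ENNReal.ofReal_prod_of_nonneg fun i _ => (Real.exp_pos _).le, ← Real.exp_sum, hv']
  rfl

lemma integrable_eval_outcomeKernel (σ : ℝ) (r : MeanOutcome V) (Z : Assignment V B) (i : V) :
    Integrable (fun y : V → ℝ => y i) (outcomeKernel σ r Z) := by
  rw [outcomeKernel_apply]
  exact integrable_comp_eval (μ := fun i => gaussianReal (r Z.1 i) (Real.toNNReal (σ ^ 2)))
    (f := fun x => x)
    ((memLp_one_iff_integrable).1 (memLp_id_gaussianReal 1))

lemma integral_eval_outcomeKernel (σ : ℝ) (r : MeanOutcome V) (Z : Assignment V B) (i : V) :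
    ∫ y, y i ∂(outcomeKernel σ r Z) = r Z.1 i := by
  rw [outcomeKernel_apply, integral_comp_eval
    (μ := fun i => gaussianReal (r Z.1 i) (Real.toNNReal (σ ^ 2))) (f := fun x => x)
    aestronglyMeasurable_id]
  exact integral_id_gaussianReal

lemma integrable_logLikelihoodRatio (σ : ℝ) (r r' : MeanOutcome V) (Z : Assignment V B) :
    Integrable (fun y => logLikelihoodRatio σ r r' (Z, y)) (outcomeKernel σ r Z) := by
  unfold logLikelihoodRatio
  dsimp only
  refine integrable_finsetSum _ fun i _ => Integrable.sub ?_ (integrable_const _)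
  exact ((integrable_eval_outcomeKernel σ r Z i).const_mul _).div_const _

/-- This is minus the relative entropy of two Gaussian vectors with equal variances, added over the
independent units. -/
lemma integral_logLikelihoodRatio (σ : ℝ) (r r' : MeanOutcome V) (Z : Assignment V B) :
    ∫ y, logLikelihoodRatio σ r r' (Z, y) ∂(outcomeKernel σ r Z) =
      -(∑ i, (r' Z.1 i - r Z.1 i) ^ 2 / (2 * σ ^ 2)) := by
  unfold logLikelihoodRatio
  have h : ∀ i, Integrable (fun y : V → ℝ => (r' Z.1 i - r Z.1 i) * y i / σ ^ 2)
      (outcomeKernel σ r Z) := fun i =>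
    ((integrable_eval_outcomeKernel σ r Z i).const_mul _).div_const _
  dsimp only
  rw [integral_finsetSum _ fun i _ => by exact (h i).sub (integrable_const _), ← Finset.sum_neg_distrib]
  refine Finset.sum_congr rfl fun i _ => ?_
  rw [integral_sub (h i) (integrable_const _), integral_div, integral_const_mul,
    integral_eval_outcomeKernel, integral_const]
  simp only [probReal_univ, one_smul]
  -- For `σ = 0` both sides vanish, since division by zero gives zero.
  by_cases hs : σ = 0
  · simp [hs]
  field_simp
  ring

/-! ### History laws and their change of measure. -/

instance (π : Policy V B) (T t : ℕ) : IsMarkovKernel (π.rule T t) := π.isMarkov T t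

lemma measurable_snoc {α : Type*} [MeasurableSpace α] (t : ℕ) :
    Measurable fun hx : (Fin t → α) × α => Fin.snoc (α := fun _ => α) hx.1 hx.2 := by
  refine measurable_pi_iff.2 fun i => ?_
  refine Fin.lastCases ?_ (fun j => ?_) i
  · simpa using measurable_snd
  · simpa [Function.comp_def] using (measurable_pi_apply j).comp measurable_fst

/-- The conditional law of the next round given the history. -/
def roundKernel (σ : ℝ) (r : MeanOutcome V) (π : Policy V B) (T t : ℕ) :
    Kernel (Fin t → Round V B) (Round V B) :=
  (π.rule T t) ⊗ₖ (Kernel.prodMkLeft (Fin t → Round V B) (outcomeKernel (B := B) σ r))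

instance (σ : ℝ) (r : MeanOutcome V) (π : Policy V B) (T t : ℕ) :
    IsMarkovKernel (roundKernel σ r π T t) := by unfold roundKernel; infer_instance

lemma historyLaw_succ (σ : ℝ) (r : MeanOutcome V) (π : Policy V B) (T t : ℕ) :
    historyLaw σ r π T (t + 1) = ((historyLaw σ r π T t) ⊗ₘ (roundKernel σ r π T t)).map
        fun hx => Fin.snoc (α := fun _ => Round V B) hx.1 hx.2 := rfl

instance isProbabilityMeasure_historyLaw (σ : ℝ) (r : MeanOutcome V) (π : Policy V B) (T t : ℕ) :
    IsProbabilityMeasure (historyLaw σ r π T t) := by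
  induction t with
  | zero => unfold historyLaw; infer_instance
  | succ t ih =>
    rw [historyLaw_succ]
    exact Measure.isProbabilityMeasure_map (measurable_snoc t).aemeasurable

lemma lintegral_roundKernel (σ : ℝ) (r : MeanOutcome V) (π : Policy V B) (T t : ℕ)
    (h : Fin t → Round V B) {F : Round V B → ENNReal} (hF : Measurable F) :
    ∫⁻ x, F x ∂(roundKernel σ r π T t h) =
      ∫⁻ Z, ∫⁻ y, F (Z, y) ∂(outcomeKernel σ r Z) ∂(π.rule T t h) := by
  rw [roundKernel, Kernel.lintegral_compProd _ _ _ hF]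
  rfl

lemma lintegral_historyLaw_succ (σ : ℝ) (r : MeanOutcome V) (π : Policy V B) (T t : ℕ)
    {F : (Fin (t + 1) → Round V B) → ENNReal} (hF : Measurable F) :
    ∫⁻ h, F h ∂(historyLaw σ r π T (t + 1)) =
      ∫⁻ h, ∫⁻ x, F (Fin.snoc (α := fun _ => Round V B) h x) ∂(roundKernel σ r π T t h)
        ∂(historyLaw σ r π T t) := by
  rw [historyLaw_succ, lintegral_map hF (measurable_snoc t),
    Measure.lintegral_compProd (by exact hF.comp (measurable_snoc t))]

/-- Change of measure: two environments under the same policy. -/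
lemma historyLaw_eq_withDensity {σ : ℝ} (hσ : 0 < σ) (r r' : MeanOutcome V) (π : Policy V B)
    (T t : ℕ) :
    historyLaw σ r' π T t = (historyLaw σ r π T t).withDensity fun h =>
      ENNReal.ofReal (Real.exp (∑ s, logLikelihoodRatio σ r r' (h s))) := by
  have hmeas : ∀ t, Measurable fun h : Fin t → Round V B =>
      ENNReal.ofReal (Real.exp (∑ s, logLikelihoodRatio σ r r' (h s))) := fun t => by fun_prop
  induction t with
  | zero =>
    have : (fun h : Fin 0 → Round V B =>
      ENNReal.ofReal (Real.exp (∑ s, logLikelihoodRatio σ r r' (h s)))) = 1 := by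
      ext h; simp
    rw [this, withDensity_one]
    rfl
  | succ t ih =>
    refine Measure.ext_of_lintegral _ fun F hF => ?_
    rw [lintegral_historyLaw_succ _ _ _ _ _ hF, ih,
      lintegral_withDensity_eq_lintegral_mul₀' (hmeas t).aemeasurable
        (Measurable.aemeasurable ?_),
      lintegral_withDensity_eq_lintegral_mul₀' (hmeas (t + 1)).aemeasurable hF.aemeasurable,
      lintegral_historyLaw_succ _ _ _ _ _ ((hmeas (t + 1)).mul hF)]
    · refine lintegral_congr fun h => ?_
      have hs : Measurable fun x => Fin.snoc (α := fun _ => Round V B) h x :=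
        (measurable_snoc t).comp measurable_prodMk_left
      rw [Pi.mul_apply, lintegral_roundKernel _ _ _ _ _ _ (by exact hF.comp hs),
        lintegral_roundKernel _ _ _ _ _ _ (by exact ((hmeas (t + 1)).mul hF).comp hs), ← lintegral_const_mul' _ _ ENNReal.ofReal_ne_top]
      -- Both environments draw `Z` from the same `π.rule`, so the policy contributes no factor to
      -- the density.
      refine lintegral_congr fun Z => ?_
      have hsZ : Measurable fun y => Fin.snoc (α := fun _ => Round V B) h (Z, y) :=
        hs.comp measurable_prodMk_left
      rw [outcomeKernel_eq_withDensity hσ r r' Z,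
        lintegral_withDensity_eq_lintegral_mul₀' (by fun_prop) (by exact (hF.comp hsZ).aemeasurable),
        ← lintegral_const_mul' _ _ ENNReal.ofReal_ne_top]
      refine lintegral_congr fun y => ?_
      simp only [Pi.mul_apply, Fin.sum_univ_castSucc, Fin.snoc_castSucc, Fin.snoc_last,
        Real.exp_add, ENNReal.ofReal_mul (Real.exp_pos _).le, mul_assoc]
    · exact Measurable.lintegral_kernel_prod_right' (κ := roundKernel σ r' π T t)
        (hF.comp (measurable_snoc t))

/-! ### Expectations of sums over rounds. -/

lemma map_fst_compProd_roundKernel (σ : ℝ) (r : MeanOutcome V) (π : Policy V B) (T t : ℕ) :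
    ((historyLaw σ r π T t) ⊗ₘ (roundKernel σ r π T t)).map Prod.fst = historyLaw σ r π T t :=
  Measure.fst_compProd _ _

lemma integrable_roundKernel (σ : ℝ) (r : MeanOutcome V) (π : Policy V B) (T t : ℕ)
    {Φ : Round V B → ℝ} (hΦ : Measurable Φ)
    (hint : ∀ Z, Integrable (fun y => Φ (Z, y)) (outcomeKernel σ r Z)) (h : Fin t → Round V B) :
    Integrable Φ (roundKernel σ r π T t h) := by
  unfold roundKernel
  rw [ProbabilityTheory.integrable_compProd_iff hΦ.aestronglyMeasurable]
  exact ⟨ae_of_all _ fun Z => hint Z, Integrable.of_finite⟩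

lemma integral_roundKernel (σ : ℝ) (r : MeanOutcome V) (π : Policy V B) (T t : ℕ)
    {Φ : Round V B → ℝ} (hΦ : Measurable Φ)
    (hint : ∀ Z, Integrable (fun y => Φ (Z, y)) (outcomeKernel σ r Z)) (h : Fin t → Round V B) :
    ∫ x, Φ x ∂(roundKernel σ r π T t h) =
      ∫ Z, ∫ y, Φ (Z, y) ∂(outcomeKernel σ r Z) ∂(π.rule T t h) := by
  have := integrable_roundKernel σ r π T t hΦ hint h
  unfold roundKernel at this ⊢
  rw [ProbabilityTheory.integral_compProd this]
  rfl

lemma integrable_compProd_roundKernel (σ : ℝ) (r : MeanOutcome V) (π : Policy V B) (T t : ℕ)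
    {Φ : Round V B → ℝ} (hΦ : Measurable Φ)
    (hint : ∀ Z, Integrable (fun y => Φ (Z, y)) (outcomeKernel σ r Z)) :
    Integrable (fun hx => Φ hx.2) ((historyLaw σ r π T t) ⊗ₘ (roundKernel σ r π T t)) := by
  rw [Measure.integrable_compProd_iff (by exact (hΦ.comp measurable_snd).aestronglyMeasurable)]
  refine ⟨ae_of_all _ fun h => integrable_roundKernel σ r π T t hΦ hint h, ?_⟩
  let _ : Fintype (Assignment V B) := Fintype.ofFinite _
  -- There are finitely many assignments, so the sum of their conditional means of `‖Φ‖` bounds the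
  -- inner integral for every history.
  refine Integrable.of_bound (C := ∑ Z, ∫ y, ‖Φ (Z, y)‖ ∂(outcomeKernel σ r Z))
    (StronglyMeasurable.integral_kernel_prod_right' (κ := roundKernel σ r π T t)
      (hΦ.comp measurable_snd).norm.stronglyMeasurable).aestronglyMeasurable (ae_of_all _ fun h => ?_)
  have h0 : ∀ Z : Assignment V B, 0 ≤ ∫ y, ‖Φ (Z, y)‖ ∂(outcomeKernel σ r Z) := fun Z =>
    integral_nonneg fun y => norm_nonneg _
  rw [integral_roundKernel σ r π T t (Φ := fun x => ‖Φ x‖) (by fun_prop) (fun Z => (hint Z).norm)]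
  refine (norm_integral_le_of_norm_le_const (C := ∑ Z, ∫ y, ‖Φ (Z, y)‖ ∂(outcomeKernel σ r Z))
    (ae_of_all _ fun Z => ?_)).trans (by simp)
  rw [Real.norm_of_nonneg (h0 Z)]
  exact Finset.single_le_sum (f := fun Z => ∫ y, ‖Φ (Z, y)‖ ∂(outcomeKernel σ r Z))
    (fun Z _ => h0 Z) (Finset.mem_univ Z)

lemma measurable_sum_round (t : ℕ) {Φ : Round V B → ℝ} (hΦ : Measurable Φ) :
    Measurable fun h : Fin t → Round V B => ∑ s, Φ (h s) :=
  Finset.measurable_fun_sum _ fun s _ => hΦ.comp (measurable_pi_apply s)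

lemma integrable_sum_historyLaw (σ : ℝ) (r : MeanOutcome V) (π : Policy V B) (T t : ℕ)
    {Φ : Round V B → ℝ} (hΦ : Measurable Φ)
    (hint : ∀ Z, Integrable (fun y => Φ (Z, y)) (outcomeKernel σ r Z)) :
    Integrable (fun h => ∑ s, Φ (h s)) (historyLaw σ r π T t) := by
  induction t with
  | zero => simp
  | succ t ih =>
    rw [historyLaw_succ, integrable_map_measure (measurable_sum_round _ hΦ |>.aestronglyMeasurable) (measurable_snoc t).aemeasurable]
    simp only [Function.comp_def, Fin.sum_univ_castSucc, Fin.snoc_castSucc, Fin.snoc_last]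
    refine Integrable.add ?_ (integrable_compProd_roundKernel σ r π T t hΦ hint)
    rw [← map_fst_compProd_roundKernel] at ih
    exact ih.comp_measurable measurable_fst

lemma integral_sum_historyLaw_succ (σ : ℝ) (r : MeanOutcome V) (π : Policy V B) (T t : ℕ)
    {Φ : Round V B → ℝ} (hΦ : Measurable Φ)
    (hint : ∀ Z, Integrable (fun y => Φ (Z, y)) (outcomeKernel σ r Z)) :
    ∫ h, ∑ s, Φ (h s) ∂(historyLaw σ r π T (t + 1)) =
      ∫ h, ∑ s, Φ (h s) ∂(historyLaw σ r π T t) +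
      ∫ h, ∫ Z, ∫ y, Φ (Z, y) ∂(outcomeKernel σ r Z) ∂(π.rule T t h)
        ∂(historyLaw σ r π T t) := by
  have h1 := integrable_sum_historyLaw σ r π T t hΦ hint
  have h2 := integrable_compProd_roundKernel σ r π T t hΦ hint
  rw [← map_fst_compProd_roundKernel] at h1
  rw [historyLaw_succ, integral_map (measurable_snoc t).aemeasurable (measurable_sum_round _ hΦ |>.aestronglyMeasurable)]
  simp only [Fin.sum_univ_castSucc, Fin.snoc_castSucc, Fin.snoc_last]
  rw [integral_add (by exact h1.comp_measurable measurable_fst) h2]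
  congr 1
  · conv_rhs => rw [← map_fst_compProd_roundKernel]
    rw [integral_map measurable_fst.aemeasurable (measurable_sum_round _ hΦ |>.aestronglyMeasurable)]
  · rw [Measure.integral_compProd h2]
    exact integral_congr_ae (ae_of_all _ fun h => integral_roundKernel σ r π T t hΦ hint h)

/-- Each round's summand may be replaced by its conditional mean given the assignment. -/
lemma integral_sum_historyLaw_eq (σ : ℝ) (r : MeanOutcome V) (π : Policy V B) (T t : ℕ)
    {Φ : Round V B → ℝ} (hΦ : Measurable Φ)
    (hint : ∀ Z, Integrable (fun y => Φ (Z, y)) (outcomeKernel σ r Z))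
    (c : Assignment V B → ℝ) (hc : ∀ Z, ∫ y, Φ (Z, y) ∂(outcomeKernel σ r Z) = c Z) :
    ∫ h, ∑ s, Φ (h s) ∂(historyLaw σ r π T t) =
      ∫ h, ∑ s, c (h s).1 ∂(historyLaw σ r π T t) := by
  have hcm : Measurable fun x : Round V B => c x.1 := (measurable_of_finite c).comp measurable_fst
  induction t with
  | zero => simp
  | succ t ih =>
    rw [integral_sum_historyLaw_succ σ r π T t hΦ hint,
      integral_sum_historyLaw_succ σ r π T t hcm fun Z => integrable_const (c Z), ih]
    simp [hc]

lemma integrable_sum_assignment (σ : ℝ) (r : MeanOutcome V) (π : Policy V B) (T t : ℕ)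
    (c : Assignment V B → ℝ) :
    Integrable (fun h => ∑ s, c (h s).1) (historyLaw σ r π T t) :=
  integrable_sum_historyLaw σ r π T t (Φ := fun x => c x.1)
    ((measurable_of_finite c).comp measurable_fst) fun Z => integrable_const (c Z)

lemma expectedRegret_eq_integral_sum (σ : ℝ) (r : MeanOutcome V) (π : Policy V B) (T : ℕ) :
    expectedRegret σ r π T = ∫ h, ∑ t, ((⨆ Z : Assignment V B, totalMean r Z.1)
      - totalMean r (h t).1.1) ∂(historyLaw σ r π T T) := by
  unfold expectedRegret
  rw [integral_finsetSum]
  intro t _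
  have hm : Measurable fun Z : Assignment V B =>
      (⨆ Z : Assignment V B, totalMean r Z.1) - totalMean r Z.1 := measurable_of_finite _
  obtain ⟨C, hC⟩ := (Set.finite_range fun Z : Assignment V B =>
    ‖(⨆ Z : Assignment V B, totalMean r Z.1) - totalMean r Z.1‖).bddAbove
  refine Integrable.of_bound (C := C) ?_ (ae_of_all _ fun h => hC ⟨(h t).1, rfl⟩)
  exact (hm.comp (measurable_fst.comp (measurable_pi_apply t))).aestronglyMeasurable

/-! ### The entropy inequality. -/

/-- A change-of-measure lower bound on the relative entropy `-∫ L dP`, where `L = log (dQ/dP)`. -/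
lemma mul_log_sub_le_neg_integral {Ω : Type*} [MeasurableSpace Ω] (P Q : Measure Ω)
    [IsProbabilityMeasure P] [IsProbabilityMeasure Q] {L : Ω → ℝ} (hL : Measurable L)
    (hint : Integrable L P) (hQ : Q = P.withDensity fun ω => ENNReal.ofReal (Real.exp (L ω)))
    {E : Set Ω} (hE : MeasurableSet E) {M : ℝ} (hM : 0 < M) :
    P.real E * Real.log M - M * Q.real E ≤ -∫ ω, L ω ∂P := by
  have hexp : Integrable (fun ω => Real.exp (L ω)) P := by
    refine ⟨hL.exp.aestronglyMeasurable, ?_⟩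
    rw [hasFiniteIntegral_iff_ofReal (ae_of_all _ fun ω => (Real.exp_pos _).le)]
    have : Q Set.univ = ∫⁻ ω, ENNReal.ofReal (Real.exp (L ω)) ∂P := by
      rw [hQ, withDensity_apply _ MeasurableSet.univ, Measure.restrict_univ]
    rw [← this, measure_univ]
    exact ENNReal.one_lt_top
  have hQr : ∀ {s : Set Ω}, MeasurableSet s → ∫ ω in s, Real.exp (L ω) ∂P = Q.real s := by
    intro s hs
    rw [Measure.real, hQ, withDensity_apply _ hs,
      integral_eq_lintegral_of_nonneg_ae (ae_of_all _ fun ω => (Real.exp_pos _).le)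
        hL.exp.aestronglyMeasurable]
  -- The inequality `1 + x ≤ exp x` is used at `x = log M + L` on `E` and at `x = L` off `E`;
  -- integrating `exp L` turns `P` into `Q`.
  have h1 : ∫ ω in E, (1 + Real.log M - M * Real.exp (L ω)) ∂P ≤ ∫ ω in E, -L ω ∂P := by
    refine integral_mono ((integrable_const _).sub (hexp.integrableOn.const_mul M))
      hint.integrableOn.neg fun ω => ?_
    have := Real.add_one_le_exp (Real.log M + L ω)
    rw [Real.exp_add, Real.exp_log hM] at this
    dsimp only
    linarith
  have h2 : ∫ ω in Eᶜ, (1 - Real.exp (L ω)) ∂P ≤ ∫ ω in Eᶜ, -L ω ∂P := by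
    refine integral_mono ((integrable_const _).sub hexp.integrableOn)
      hint.integrableOn.neg fun ω => ?_
    have := Real.add_one_le_exp (L ω)
    dsimp only
    linarith
  rw [integral_sub (integrable_const _) (hexp.integrableOn.const_mul M), integral_const_mul,
    hQr hE, setIntegral_const] at h1
  rw [integral_sub (integrable_const _) hexp.integrableOn, hQr hE.compl, setIntegral_const] at h2
  have h3 := integral_add_compl hE hint.neg
  simp only [Pi.neg_apply, integral_neg (f := L) (μ := P)] at h3
  rw [probReal_compl_eq_one_sub hE] at h2
  rw [probReal_compl_eq_one_sub hE] at h2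
  simp only [smul_eq_mul] at h1 h2
  -- Adding the two pieces gives the claim with an extra `Q.real E` on the left, which is dropped.
  have h4 : 0 ≤ Q.real E := measureReal_nonneg
  linarith

/-! ### Environments on pairs. -/

variable {p : ℕ}

/-- The mean outcomes in which treating a unit of pair `k` yields `θ k` at its partner. -/
def pairMean (θ : Fin p → ℝ) : MeanOutcome (PairNode p) := fun Z i =>
  θ i.1 * if Z (i.1, !i.2) = true then 1 else 0

/-- The network in which exactly the pairs in `S` are connected. -/
def pairNetwork (S : Set (Fin p)) : SimpleGraph (PairNode p) where
  Adj u v := u.1 = v.1 ∧ u.1 ∈ S ∧ v.2 = !u.2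
  symm := ⟨by
    rintro ⟨u, b⟩ ⟨v, c⟩ ⟨h1, h2, h3⟩
    dsimp only at *
    subst h1 h3
    simp [h2]⟩
  loopless := ⟨by rintro ⟨u, b⟩ ⟨-, -, h⟩; simp at h⟩

/-- `pairNetwork S` as a pair network. -/
def pairGraph (S : Set (Fin p)) : PairGraph p := ⟨pairNetwork S, fun _ _ h => h.1⟩

/-- The number of treated units in pair `k`. -/
def treatedInPair (k : Fin p) (Z : PairNode p → Bool) : ℝ :=
  ∑ b : Bool, if Z (k, b) = true then 1 else 0

lemma pairMean_satisfiesNIA (S : Set (Fin p)) (θ : Fin p → ℝ) (hθ : ∀ k ∉ S, θ k = 0) :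
    SatisfiesNIA (pairNetwork S) (pairMean θ) := by
  rintro ⟨k, b⟩ Z Z' - h
  by_cases hk : k ∈ S
  · simp only [pairMean, h (k, !b) ⟨rfl, hk, rfl⟩]
  · simp [pairMean, hθ k hk]

lemma pairMean_zeroDirectEffect (S : Set (Fin p)) (θ : Fin p → ℝ) (hθ : ∀ k ∉ S, θ k = 0) :
    ZeroDirectEffect (pairNetwork S) (pairMean θ) := by
  rintro ⟨k, b⟩ Z h
  by_cases hk : k ∈ S
  · simp [pairMean, h (k, !b) ⟨rfl, hk, rfl⟩]
  · simp [pairMean, hθ k hk]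

lemma treatedNeighbors_pairNetwork (S : Set (Fin p)) [DecidablePred (· ∈ S)]
    (Z : PairNode p → Bool) (i : PairNode p) :
    treatedNeighbors (pairNetwork S) Z i = if i.1 ∈ S ∧ Z (i.1, !i.2) = true then 1 else 0 := by
  have hiff : ∀ j, (pairNetwork S).Adj i j ∧ Z j = true ↔
      j = (i.1, !i.2) ∧ i.1 ∈ S ∧ Z (i.1, !i.2) = true := by
    rintro ⟨k, b⟩
    constructor
    · rintro ⟨⟨h1, h2, h3⟩, h4⟩
      have hj : (k, b) = (i.1, !i.2) := Prod.ext h1.symm h3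
      exact ⟨hj, h2, hj ▸ h4⟩
    · rintro ⟨hj, h2, h4⟩
      rw [hj]
      exact ⟨⟨rfl, h2, rfl⟩, h4⟩
  unfold treatedNeighbors
  simp_rw [hiff]
  split_ifs with h
  · simp [h]
  · simp [h]

lemma spilloverMean_pairNetwork_singleton (γ₁ : ℝ) (k : Fin p) :
    spilloverMean 0 γ₁ (pairNetwork {k}) = pairMean (Pi.single k γ₁) := by
  ext Z i
  simp only [spilloverMean, pairMean, zero_mul, zero_add, treatedNeighbors_pairNetwork,
    Set.mem_singleton_iff, Pi.single_apply]
  split_ifs <;> simp_all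

/-- Swapping the two units of each pair turns "the partner is treated" into "the unit is treated".
-/
lemma sum_pairNode_mul (c : Fin p → ℝ) (Z : PairNode p → Bool) :
    ∑ i : PairNode p, c i.1 * (if Z (i.1, !i.2) = true then 1 else 0) =
      ∑ k, c k * treatedInPair k Z := by
  rw [Fintype.sum_prod_type]
  refine Finset.sum_congr rfl fun k _ => ?_
  rw [treatedInPair, Finset.mul_sum]
  exact Fintype.sum_equiv (Equiv.boolNot) _ _ fun b => by simp

lemma totalMean_pairMean (θ : Fin p → ℝ) (Z : PairNode p → Bool) :
    totalMean (pairMean θ) Z = ∑ k, θ k * treatedInPair k Z :=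
  sum_pairNode_mul θ Z

/-- The difference of the means is a coefficient times an indicator, and an indicator equals its
square. -/
lemma sum_sq_pairMean_sub (θ θ' : Fin p → ℝ) (s : ℝ) (Z : PairNode p → Bool) :
    ∑ i, (pairMean θ' Z i - pairMean θ Z i) ^ 2 / s =
      ∑ k, (θ' k - θ k) ^ 2 / s * treatedInPair k Z := by
  rw [← sum_pairNode_mul fun k => (θ' k - θ k) ^ 2 / s]
  refine Finset.sum_congr rfl fun i _ => ?_
  unfold pairMean
  split_ifs <;> simp

lemma treatedInPair_nonneg (k : Fin p) (Z : PairNode p → Bool) : 0 ≤ treatedInPair k Z :=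
  Finset.sum_nonneg fun b _ => by split_ifs <;> norm_num

lemma sum_treatedInPair_le_one (Z : Assignment (PairNode p) 1) :
    ∑ k, treatedInPair k Z.1 ≤ 1 := by
  unfold treatedInPair
  rw [← Fintype.sum_prod_type (f := fun i : PairNode p => if Z.1 i = true then (1 : ℝ) else 0),
    Finset.sum_boole]
  exact_mod_cast Z.2

/-- Treating one given unit only. -/
def singleAssignment (i : PairNode p) : Assignment (PairNode p) 1 :=
  ⟨fun j => decide (j = i), by simp [Finset.filter_eq']⟩

lemma treatedInPair_singleAssignment (k j : Fin p) (b : Bool) :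
    treatedInPair k (singleAssignment (j, b)).1 = if k = j then 1 else 0 := by
  by_cases h : k = j <;> cases b <;> simp [treatedInPair, singleAssignment, h]

lemma bddAbove_totalMean {V : Type} [Fintype V] {B : ℕ} (r : MeanOutcome V) :
    BddAbove (Set.range fun Z : Assignment V B => totalMean r Z.1) :=
  (Set.finite_range _).bddAbove

lemma le_iSup_totalMean_pairMean (θ : Fin p → ℝ) (k : Fin p) :
    θ k ≤ ⨆ Z : Assignment (PairNode p) 1, totalMean (pairMean θ) Z.1 := by
  refine le_trans (le_of_eq ?_) (le_ciSup (bddAbove_totalMean _) (singleAssignment (k, true)))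
  simp [totalMean_pairMean, treatedInPair_singleAssignment]

instance : Finite (PairGraph p) := by unfold PairGraph; infer_instance

/-! ### Regret and the number of plays of a pair. -/

lemma expectedRegret_nonneg {V : Type} [Fintype V] {B : ℕ} (σ : ℝ) (r : MeanOutcome V)
    (π : Policy V B) (T : ℕ) : 0 ≤ expectedRegret σ r π T :=
  Finset.sum_nonneg fun t _ => integral_nonneg fun h =>
    sub_nonneg.2 (le_ciSup (bddAbove_totalMean r) (h t).1)

lemma le_expectedRegret_of_le {V : Type} [Fintype V] {B : ℕ} (σ : ℝ) (r : MeanOutcome V)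
    (π : Policy V B) (T : ℕ) (c : Assignment V B → ℝ)
    (hc : ∀ Z, c Z ≤ (⨆ Z : Assignment V B, totalMean r Z.1) - totalMean r Z.1) :
    ∫ h, ∑ t, c (h t).1 ∂(historyLaw σ r π T T) ≤ expectedRegret σ r π T := by
  rw [expectedRegret_eq_integral_sum]
  refine integral_mono (integrable_sum_assignment σ r π T T c)
    (integrable_sum_assignment σ r π T T fun Z =>
      (⨆ Z : Assignment V B, totalMean r Z.1) - totalMean r Z.1) fun h => ?_
  exact Finset.sum_le_sum fun t _ => hc _

/-- The expected number of treatments in pair `k` over the horizon. -/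
def expectedPlays (σ : ℝ) (r : MeanOutcome (PairNode p)) (π : Policy (PairNode p) 1) (T : ℕ)
    (k : Fin p) : ℝ :=
  ∫ h, ∑ t, treatedInPair k (h t).1.1 ∂(historyLaw σ r π T T)

lemma integrable_sum_treatedInPair (σ : ℝ) (r : MeanOutcome (PairNode p))
    (π : Policy (PairNode p) 1) (T : ℕ) (k : Fin p) :
    Integrable (fun h => ∑ t, treatedInPair k (h t).1.1) (historyLaw σ r π T T) :=
  integrable_sum_assignment σ r π T T fun Z => treatedInPair k Z.1

/-- When only pair `i` is connected, every play of another pair costs `γ₁`. -/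
lemma sum_expectedPlays_le_expectedRegret (σ : ℝ) {γ₁ : ℝ} (hγ : 0 < γ₁) (i : Fin p)
    (π : Policy (PairNode p) 1) (T : ℕ) :
    γ₁ * ∑ k ∈ Finset.univ.erase i, expectedPlays σ (pairMean (Pi.single i γ₁)) π T k ≤
      expectedRegret σ (pairMean (Pi.single i γ₁)) π T := by
  refine le_trans (le_of_eq ?_) (le_expectedRegret_of_le σ _ π T
    (fun Z => γ₁ * ∑ k ∈ Finset.univ.erase i, treatedInPair k Z.1) fun Z => ?_)
  · unfold expectedPlays
    rw [← integral_finsetSum _ fun k _ => integrable_sum_treatedInPair σ _ π T k,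
      ← integral_const_mul]
    refine integral_congr_ae (ae_of_all _ fun h => ?_)
    dsimp only
    rw [← Finset.mul_sum, Finset.sum_comm]
  · have h1 := le_iSup_totalMean_pairMean (Pi.single i γ₁) i
    have h2 := sum_treatedInPair_le_one Z
    rw [← Finset.add_sum_erase _ _ (Finset.mem_univ i)] at h2
    have h3 : totalMean (pairMean (Pi.single i γ₁)) Z.1 = γ₁ * treatedInPair i Z.1 := by
      rw [totalMean_pairMean, Finset.sum_eq_single i (fun j _ hj => by
        rw [Pi.single_eq_of_ne hj, zero_mul]) (by simp), Pi.single_eq_same]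
    rw [Pi.single_eq_same] at h1
    rw [h3]
    nlinarith

/-- When pair `k` has the largest spillover `γ₁ + δ`, every other play costs at least `δ`. -/
lemma mul_sub_expectedPlays_le_expectedRegret (σ : ℝ) {γ₁ δ : ℝ} (hγ : 0 < γ₁)
    {i k : Fin p} (hik : k ≠ i) (π : Policy (PairNode p) 1) (T : ℕ) :
    δ * (T - expectedPlays σ (pairMean (Pi.single i γ₁ + Pi.single k (γ₁ + δ))) π T k) ≤
      expectedRegret σ (pairMean (Pi.single i γ₁ + Pi.single k (γ₁ + δ))) π T := by
  refine le_trans (le_of_eq ?_) (le_expectedRegret_of_le σ _ π T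
    (fun Z => δ * (1 - treatedInPair k Z.1)) fun Z => ?_)
  · have : ∀ h : Fin T → Round (PairNode p) 1, ∑ t, δ * (1 - treatedInPair k (h t).1.1) =
        δ * (T - ∑ t, treatedInPair k (h t).1.1) := fun h => by
      rw [← Finset.mul_sum, Finset.sum_sub_distrib]; simp
    simp_rw [this]
    rw [integral_const_mul, integral_sub (integrable_const _)
      (integrable_sum_treatedInPair σ _ π T k), integral_const, probReal_univ, one_smul]
    rfl
  · have h1 := le_iSup_totalMean_pairMean (Pi.single i γ₁ + Pi.single k (γ₁ + δ)) k
    have h2 : treatedInPair i Z.1 + treatedInPair k Z.1 ≤ 1 := by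
      refine le_trans ?_ (sum_treatedInPair_le_one Z)
      rw [← Finset.sum_pair (f := fun j => treatedInPair j Z.1) hik.symm]
      exact Finset.sum_le_sum_of_subset_of_nonneg (Finset.subset_univ _) fun j _ _ =>
        treatedInPair_nonneg _ _
    have h3 : totalMean (pairMean (Pi.single i γ₁ + Pi.single k (γ₁ + δ))) Z.1 =
        γ₁ * treatedInPair i Z.1 + (γ₁ + δ) * treatedInPair k Z.1 := by
      simp [totalMean_pairMean, add_mul, Finset.sum_add_distrib, Pi.single_apply, ite_mul]
    simp only [Pi.add_apply, Pi.single_eq_same, Pi.single_eq_of_ne hik, zero_add] at h1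
    rw [h3]
    -- The gap is at least `δ (1 - n_k) + γ₁ (1 - n_i - n_k)`, where `n` counts treatments in a
    -- pair; the second term is nonnegative by the budget.
    nlinarith

/-! ### Information gained about an unconnected pair. -/

lemma neg_integral_sum_logLikelihoodRatio (σ γ₁ m : ℝ) (i k : Fin p)
    (π : Policy (PairNode p) 1) (T : ℕ) :
    -∫ h, ∑ t, logLikelihoodRatio σ (pairMean (Pi.single i γ₁))
        (pairMean (Pi.single i γ₁ + Pi.single k m)) (h t)
        ∂(historyLaw σ (pairMean (Pi.single i γ₁)) π T T) =
      m ^ 2 / (2 * σ ^ 2) * expectedPlays σ (pairMean (Pi.single i γ₁)) π T k := by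
  rw [integral_sum_historyLaw_eq σ _ π T T (measurable_logLikelihoodRatio σ _ _)
    (integrable_logLikelihoodRatio σ _ _) (fun Z => -(m ^ 2 / (2 * σ ^ 2) * treatedInPair k Z.1))]
  · simp_rw [Finset.sum_neg_distrib, ← Finset.mul_sum]
    rw [integral_neg, integral_const_mul, neg_neg]
    rfl
  · intro Z
    rw [integral_logLikelihoodRatio, sum_sq_pairMean_sub, Finset.sum_eq_single k]
    · simp
    · intro j _ hj
      simp [Pi.single_eq_of_ne hj]
    · simp

lemma sum_treatedInPair_nonneg {T : ℕ} (k : Fin p) (h : Fin T → Round (PairNode p) 1) :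
    0 ≤ ∑ t, treatedInPair k (h t).1.1 :=
  Finset.sum_nonneg fun _ _ => treatedInPair_nonneg _ _

lemma expectedPlays_nonneg (σ : ℝ) (r : MeanOutcome (PairNode p)) (π : Policy (PairNode p) 1)
    (T : ℕ) (k : Fin p) : 0 ≤ expectedPlays σ r π T k :=
  integral_nonneg fun h => sum_treatedInPair_nonneg k h

lemma sum_treatedInPair_le {T : ℕ} (k : Fin p) (h : Fin T → Round (PairNode p) 1) :
    ∑ t, treatedInPair k (h t).1.1 ≤ T := by
  refine (Finset.sum_le_sum (g := fun _ => (1 : ℝ)) fun t _ => ?_).trans (by simp)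
  exact (Finset.single_le_sum (f := fun k => treatedInPair k (h t).1.1)
    (fun _ _ => treatedInPair_nonneg _ _) (Finset.mem_univ k)).trans
      (sum_treatedInPair_le_one (h t).1)

/-- Markov's inequality for the number of plays of pair `k`; used in the base environment. -/
lemma one_sub_le_measureReal_few_plays (σ : ℝ) (r : MeanOutcome (PairNode p))
    (π : Policy (PairNode p) 1) {T : ℕ} (hT : 0 < T) (k : Fin p) :
    1 - 2 * expectedPlays σ r π T k / T ≤
      (historyLaw σ r π T T).real {h | ∑ t, treatedInPair k (h t).1.1 < (T : ℝ) / 2} := by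
  have hT' : (0 : ℝ) < T := by exact_mod_cast hT
  have hm : Measurable fun h : Fin T → Round (PairNode p) 1 => ∑ t, treatedInPair k (h t).1.1 :=
    measurable_sum_round T (Φ := fun x : Round (PairNode p) 1 => treatedInPair k x.1.1)
      ((measurable_of_finite fun Z : Assignment (PairNode p) 1 => treatedInPair k Z.1).comp
        measurable_fst)
  have h := mul_meas_ge_le_integral_of_nonneg (ae_of_all _ fun h => sum_treatedInPair_nonneg k h)
    (integrable_sum_treatedInPair σ r π T k) ((T : ℝ) / 2)
  have hc : {h : Fin T → Round (PairNode p) 1 | ∑ t, treatedInPair k (h t).1.1 < (T : ℝ) / 2}ᶜ =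
      {h | (T : ℝ) / 2 ≤ ∑ t, treatedInPair k (h t).1.1} := by
    ext h; simp
  rw [← hc, probReal_compl_eq_one_sub (measurableSet_lt hm measurable_const)] at h
  change _ ≤ expectedPlays σ r π T k at h
  rw [sub_le_comm, le_div_iff₀ hT']
  linarith

/-- Markov's inequality for `T` minus the number of plays of pair `k`; used in the alternative
environment. -/
lemma measureReal_few_plays_le (σ : ℝ) (r : MeanOutcome (PairNode p))
    (π : Policy (PairNode p) 1) {T : ℕ} (hT : 0 < T) (k : Fin p) :
    (historyLaw σ r π T T).real {h | ∑ t, treatedInPair k (h t).1.1 < (T : ℝ) / 2} ≤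
      2 * (T - expectedPlays σ r π T k) / T := by
  have hT' : (0 : ℝ) < T := by exact_mod_cast hT
  have h := mul_meas_ge_le_integral_of_nonneg (μ := historyLaw σ r π T T)
    (f := fun h => (T : ℝ) - ∑ t, treatedInPair k (h t).1.1)
    (ae_of_all _ fun h => sub_nonneg.2 (sum_treatedInPair_le k h))
    ((integrable_const _).sub (integrable_sum_treatedInPair σ r π T k)) ((T : ℝ) / 2)
  rw [integral_sub (integrable_const _) (integrable_sum_treatedInPair σ r π T k),
    integral_const, probReal_univ, one_smul] at h
  change _ ≤ (T : ℝ) - expectedPlays σ r π T k at h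
  have hsub : (historyLaw σ r π T T).real {h | ∑ t, treatedInPair k (h t).1.1 < (T : ℝ) / 2} ≤
      (historyLaw σ r π T T).real {h | (T : ℝ) / 2 ≤ T - ∑ t, treatedInPair k (h t).1.1} := by
    refine measureReal_mono fun h hh => ?_
    have hh' : ∑ t, treatedInPair k (h t).1.1 < (T : ℝ) / 2 := hh
    change (T : ℝ) / 2 ≤ T - ∑ t, treatedInPair k (h t).1.1
    linarith
  rw [le_div_iff₀ hT']
  nlinarith

/-- Finite-horizon lower bound on the exploration of an unconnected pair `k`, in terms of the
regret in the true environment and in the one where `k` has the largest spillover. -/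
lemma log_le_expectedPlays {σ γ₁ δ : ℝ} (hσ : 0 < σ) (hγ : 0 < γ₁) (hδ : 0 < δ) {i k : Fin p}
    (hik : k ≠ i) (π : Policy (PairNode p) 1) {T : ℕ} (hT : 0 < T) {M : ℝ} (hM : 1 ≤ M) :
    (1 - 2 / γ₁ * (expectedRegret σ (pairMean (Pi.single i γ₁)) π T / T)) * Real.log M -
        M * (2 / δ *
          (expectedRegret σ (pairMean (Pi.single i γ₁ + Pi.single k (γ₁ + δ))) π T / T)) ≤
      (γ₁ + δ) ^ 2 / (2 * σ ^ 2) * expectedPlays σ (pairMean (Pi.single i γ₁)) π T k := by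
  have hT' : (0 : ℝ) < T := by exact_mod_cast hT
  have hm : Measurable fun h : Fin T → Round (PairNode p) 1 => ∑ t, treatedInPair k (h t).1.1 :=
    measurable_sum_round T (Φ := fun x : Round (PairNode p) 1 => treatedInPair k x.1.1)
      ((measurable_of_finite fun Z : Assignment (PairNode p) 1 => treatedInPair k Z.1).comp
        measurable_fst)
  rw [← neg_integral_sum_logLikelihoodRatio]
  set r := pairMean (Pi.single i γ₁)
  set r' := pairMean (Pi.single i γ₁ + Pi.single k (γ₁ + δ))
  refine le_trans ?_ (mul_log_sub_le_neg_integral (historyLaw σ r π T T) (historyLaw σ r' π T T)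
    (measurable_sum_round T (measurable_logLikelihoodRatio σ r r'))
    (integrable_sum_historyLaw σ r π T T (measurable_logLikelihoodRatio σ r r')
      (integrable_logLikelihoodRatio σ r r'))
    (historyLaw_eq_withDensity hσ r r' π T T)
    (E := {h | ∑ t, treatedInPair k (h t).1.1 < (T : ℝ) / 2})
    (measurableSet_lt hm measurable_const) (zero_lt_one.trans_le hM))
  have h1 : expectedPlays σ r π T k ≤ expectedRegret σ r π T / γ₁ := by
    rw [le_div_iff₀' hγ]
    refine le_trans ?_ (sum_expectedPlays_le_expectedRegret σ hγ i π T)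
    refine mul_le_mul_of_nonneg_left ?_ hγ.le
    exact Finset.single_le_sum (f := expectedPlays σ r π T)
      (fun j _ => expectedPlays_nonneg σ r π T j)
      (Finset.mem_erase.2 ⟨hik, Finset.mem_univ k⟩)
  have h2 : T - expectedPlays σ r' π T k ≤ expectedRegret σ r' π T / δ := by
    rw [le_div_iff₀' hδ]
    exact mul_sub_expectedPlays_le_expectedRegret σ hγ hik π T
  refine sub_le_sub (mul_le_mul_of_nonneg_right ?_ (Real.log_nonneg hM))
    (mul_le_mul_of_nonneg_left ?_ (zero_le_one.trans hM))
  · refine le_trans ?_ (one_sub_le_measureReal_few_plays σ r π hT k)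
    have : 2 / γ₁ * (expectedRegret σ r π T / T) = 2 * (expectedRegret σ r π T / γ₁) / T := by
      field_simp
    rw [this]
    gcongr
  · refine (measureReal_few_plays_le σ r' π hT k).trans ?_
    have : 2 / δ * (expectedRegret σ r' π T / T) = 2 * (expectedRegret σ r' π T / δ) / T := by
      field_simp
    rw [this]
    gcongr

/-! ### Asymptotics. -/

/-- The lower bound on `R_T / log T` obtained from `log_le_expectedPlays` with threshold
`T ^ (1 - a)`. -/
lemma le_expectedRegret_div_log {σ γ₁ δ : ℝ} (hσ : 0 < σ) (hγ : 0 < γ₁) (hδ : 0 < δ) (i : Fin p)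
    (π : Policy (PairNode p) 1) {T : ℕ} (hT : 1 < T) {a : ℝ} (ha : a ≤ 1) :
    γ₁ * ∑ k ∈ Finset.univ.erase i, 2 * σ ^ 2 / (γ₁ + δ) ^ 2 *
      ((1 - 2 / γ₁ * (expectedRegret σ (pairMean (Pi.single i γ₁)) π T / (T : ℝ) ^ (1 : ℝ)))
          * (1 - a) -
        2 / δ * (expectedRegret σ (pairMean (Pi.single i γ₁ + Pi.single k (γ₁ + δ))) π T
          / (T : ℝ) ^ a) * (Real.log T)⁻¹) ≤
      expectedRegret σ (pairMean (Pi.single i γ₁)) π T / Real.log T := by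
  have hT' : (1 : ℝ) < T := by exact_mod_cast hT
  have hT0 : (0 : ℝ) < T := by linarith
  have hlog : 0 < Real.log T := Real.log_pos hT'
  rw [le_div_iff₀ hlog]
  refine le_trans ?_ (sum_expectedPlays_le_expectedRegret σ hγ i π T)
  rw [mul_assoc, Finset.sum_mul]
  refine mul_le_mul_of_nonneg_left (Finset.sum_le_sum fun k hk => ?_) hγ.le
  have hM : (1 : ℝ) ≤ (T : ℝ) ^ (1 - a) := Real.one_le_rpow hT'.le (by linarith)
  have h := log_le_expectedPlays hσ hγ hδ (Finset.ne_of_mem_erase hk) π (by omega : 0 < T) hM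
  -- With `M = T^(1-a)`, `M * (R' / T)` becomes `R' / T^a`, the ratio that consistency controls.
  rw [Real.log_rpow hT0, Real.rpow_sub hT0, Real.rpow_one] at h
  rw [Real.rpow_one]
  have hc : 0 < 2 * σ ^ 2 / (γ₁ + δ) ^ 2 := by positivity
  have h' := mul_le_mul_of_nonneg_left h hc.le
  refine le_trans (le_of_eq ?_) (h'.trans (le_of_eq ?_))
  · have : (T : ℝ) ^ a ≠ 0 := (Real.rpow_pos_of_pos hT0 a).ne'
    field_simp
  · field_simp

lemma tendsto_lower_bound {σ γ₁ δ : ℝ} (i : Fin p)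
    (π : Policy (PairNode p) 1) (hπ : IsConsistent σ π) {a : ℝ} (ha : 0 < a) :
    Tendsto (fun T : ℕ => γ₁ * ∑ k ∈ Finset.univ.erase i, 2 * σ ^ 2 / (γ₁ + δ) ^ 2 *
      ((1 - 2 / γ₁ * (expectedRegret σ (pairMean (Pi.single i γ₁)) π T / (T : ℝ) ^ (1 : ℝ)))
          * (1 - a) -
        2 / δ * (expectedRegret σ (pairMean (Pi.single i γ₁ + Pi.single k (γ₁ + δ))) π T
          / (T : ℝ) ^ a) * (Real.log T)⁻¹)) atTop
      (𝓝 (γ₁ * (((p : ℝ) - 1) * (2 * σ ^ 2 / (γ₁ + δ) ^ 2 * (1 - a))))) := by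
  have hcard : ((Finset.univ.erase i).card : ℝ) = (p : ℝ) - 1 := by
    rw [Finset.card_erase_of_mem (Finset.mem_univ i), Finset.card_univ, Fintype.card_fin,
      Nat.cast_sub (Nat.one_le_of_lt i.2), Nat.cast_one]
  have hlog : Tendsto (fun T : ℕ => (Real.log (T : ℝ))⁻¹) atTop (𝓝 0) :=
    tendsto_inv_atTop_zero.comp (Real.tendsto_log_atTop.comp tendsto_natCast_atTop_atTop)
  have hbase : Tendsto (fun T : ℕ => expectedRegret σ (pairMean (Pi.single i γ₁)) π T
      / (T : ℝ) ^ (1 : ℝ)) atTop (𝓝 0) := by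
    have hS : ∀ j ∉ (Set.univ : Set (Fin p)), (Pi.single i γ₁ : Fin p → ℝ) j = 0 :=
      fun j hj => absurd trivial hj
    -- The fully connected network admits every `pairMean θ`, zero spillovers included, so it serves
    -- for both environments.
    exact hπ (pairGraph Set.univ) _ (pairMean_satisfiesNIA _ _ hS)
      (pairMean_zeroDirectEffect _ _ hS) 1 one_pos
  rw [← hcard, ← nsmul_eq_mul, ← Finset.sum_const]
  refine (tendsto_finsetSum _ fun k _ => ?_).const_mul _
  have halt : Tendsto (fun T : ℕ =>
      expectedRegret σ (pairMean (Pi.single i γ₁ + Pi.single k (γ₁ + δ))) π T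
      / (T : ℝ) ^ a) atTop (𝓝 0) := by
    have hS : ∀ j ∉ (Set.univ : Set (Fin p)),
        (Pi.single i γ₁ + Pi.single k (γ₁ + δ) : Fin p → ℝ) j = 0 := fun j hj => absurd trivial hj
    exact hπ (pairGraph Set.univ) _ (pairMean_satisfiesNIA _ _ hS)
      (pairMean_zeroDirectEffect _ _ hS) a ha
  have h := (((hbase.const_mul (2 / γ₁)).const_sub 1).mul_const (1 - a)).sub
    ((halt.const_mul (2 / δ)).mul hlog)
  simpa using h.const_mul (2 * σ ^ 2 / (γ₁ + δ) ^ 2)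

lemma expectedRegret_le_iSup (σ γ₁ : ℝ) (π : Policy (PairNode p) 1) (T : ℕ) (A : PairGraph p) :
    expectedRegret σ (spilloverMean 0 γ₁ A.1) π T ≤
      ⨆ A : PairGraph p, expectedRegret σ (spilloverMean 0 γ₁ A.1) π T :=
  le_ciSup (f := fun A : PairGraph p => expectedRegret σ (spilloverMean 0 γ₁ A.1) π T)
    (Set.finite_range _).bddAbove A

lemma lower_bound_le_liminf {σ γ₁ δ : ℝ} (hσ : 0 < σ) (hγ : 0 < γ₁) (hδ : 0 < δ) (i : Fin p)
    (π : Policy (PairNode p) 1) (hπ : IsConsistent σ π) {a : ℝ} (ha : 0 < a) (ha1 : a ≤ 1) :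
    ((γ₁ * (((p : ℝ) - 1) * (2 * σ ^ 2 / (γ₁ + δ) ^ 2 * (1 - a))) : ℝ) : EReal) ≤
      liminf (fun T : ℕ => (((⨆ A : PairGraph p,
        expectedRegret σ (spilloverMean 0 γ₁ A.1) π T) / Real.log (T : ℝ) : ℝ) : EReal)) atTop := by
  rw [← ((continuous_coe_real_ereal.tendsto _).comp
    (tendsto_lower_bound (γ₁ := γ₁) (δ := δ) i π hπ ha)).liminf_eq]
  refine liminf_le_liminf ?_
  filter_upwards [eventually_gt_atTop 1] with T hT
  refine EReal.coe_le_coe_iff.2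
    ((le_expectedRegret_div_log hσ hγ hδ i π hT ha1).trans ?_)
  have hlog : 0 < Real.log T := Real.log_pos (by exact_mod_cast hT)
  refine div_le_div_of_nonneg_right ?_ hlog.le
  rw [← spilloverMean_pairNetwork_singleton]
  exact expectedRegret_le_iSup σ γ₁ π T (pairGraph {i})

end NetworkBandit

end

theorem theorem3 (p : ℕ) (σ γ₁ : ℝ) (hσ : 0 < σ) (hγ : 0 < γ₁)
    (π : NetworkBandit.Policy (NetworkBandit.PairNode p) 1)
    (hπ : NetworkBandit.IsConsistent σ π) :
    ((2 * ((p : ℝ) - 1) * σ ^ 2 / γ₁ : ℝ) : EReal) ≤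
      Filter.liminf
        (fun T : ℕ =>
          (((⨆ A : NetworkBandit.PairGraph p,
              NetworkBandit.expectedRegret σ (NetworkBandit.spilloverMean 0 γ₁ A.1) π T) /
            Real.log (T : ℝ) : ℝ) : EReal))
        Filter.atTop := by
  -- With no pairs there is no `i` to connect, but then the claimed bound is nonpositive and the
  -- regret is nonnegative.
  rcases Nat.eq_zero_or_pos p with rfl | hp
  · have h0 : 2 * (((0 : ℕ) : ℝ) - 1) * σ ^ 2 / γ₁ ≤ 0 :=
      div_nonpos_of_nonpos_of_nonneg (by rw [Nat.cast_zero]; nlinarith [sq_nonneg σ]) hγ.le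
    refine (EReal.coe_le_coe_iff.2 h0).trans (le_liminf_of_le (by isBoundedDefault) ?_)
    filter_upwards with T
    refine EReal.coe_le_coe_iff.2 (div_nonneg ?_ (Real.log_natCast_nonneg T))
    exact (NetworkBandit.expectedRegret_nonneg σ _ π T).trans
      (NetworkBandit.expectedRegret_le_iSup σ γ₁ π T (NetworkBandit.pairGraph ∅))
  -- The single sequence `1 / (n + 1)` serves as both `δ` and `a`; it is positive and at most one.
  · have hε : Tendsto (fun n : ℕ => 1 / ((n : ℝ) + 1)) atTop (𝓝 0) :=
      tendsto_one_div_add_atTop_nhds_zero_nat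
    have hlim : Tendsto (fun n : ℕ => γ₁ * (((p : ℝ) - 1) *
        (2 * σ ^ 2 / (γ₁ + 1 / ((n : ℝ) + 1)) ^ 2 * (1 - 1 / ((n : ℝ) + 1))))) atTop
        (𝓝 (γ₁ * (((p : ℝ) - 1) * (2 * σ ^ 2 / (γ₁ + 0) ^ 2 * (1 - 0))))) :=
      (((tendsto_const_nhds.div ((hε.const_add γ₁).pow 2) (by positivity)).mul
        (hε.const_sub 1)).const_mul _).const_mul _
    have heq : γ₁ * (((p : ℝ) - 1) * (2 * σ ^ 2 / (γ₁ + 0) ^ 2 * (1 - 0))) =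
        2 * ((p : ℝ) - 1) * σ ^ 2 / γ₁ := by
      field_simp
      ring
    rw [heq] at hlim
    refine le_of_tendsto' ((continuous_coe_real_ereal.tendsto _).comp hlim) fun n => ?_
    have hn : (0 : ℝ) < n + 1 := by positivity
    exact NetworkBandit.lower_bound_le_liminf hσ hγ (by positivity) ⟨0, hp⟩ π hπ (by positivity)
      ((div_le_one hn).2 (by linarith [Nat.cast_nonneg (α := ℝ) n]))
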